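/- **Setting.** Let $d\in\{2,3\}$, let $\Omega\subset\mathbb R^d$ be a bounded polygonal/polyhedral domain, and let $\mathcal T_h$ be a regular (conforming simplicial) triangulation of $\Omega$. For $K\in\mathcal T_h$ let $\mathcal V_K$ be its set of $d+1$ vertices, and for $p\in\mathcal V_K$ let $\phi^K_p$ be the function that is affine on $K$ with $\phi_p^K(q)=\delta_{pq}$ for $q\in\mathcal V_K$, and that vanishes outside $K$. Let $$\mathcal V_h=\{v\in L^2(\Omega): v|_K\in\mathcal P_1(K)\ \ \forall K\in\mathcal T_h\},$$ and write $v^K=v|_K$ and $\mathbf v_K=(v^K(p))_{p\in\mathcal V_K}$ for $v\in\mathcal V_h$. Let $\mathcal E_h$ be the set of all edges ($d=2$) or faces ($d=3$) $e$ of the mesh, with diameters $h_e$. On an interior $e=\partial K^+\cap\partial K^-$ put $[\![v]\!]=v^+n^++v^-n^-$ and $\{\!\{\nabla v\}\!\}=\frac12(\nabla v^++\nabla v^-)$, and on a boundary $e$ put $[\![v]\!]=v\,n$ and $\{\!\{\nabla v\}\!\}=\nabla v$, where $n$ is the outward unit normal. For a penalty parameter $\eta>0$ let $$\mathcal A^{SIP}(v,w)=\sum_{K\in\mathcal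 T_h}\int_K\nabla v\cdot\nabla w\,dx-\sum_{e\in\mathcal E_h}\int_e\{\!\{\nabla v\}\!\}\cdot[\![w]\!]\,ds-\sum_{e\in\mathcal E_h}\int_e\{\!\{\nabla w\}\!\}\cdot[\![v]\!]\,ds+\sum_{e\in\mathcal E_h}\int_e\frac{\eta}{h_e}[\![v]\!]\cdot[\![w]\!]\,ds .$$ Let $\nu>0$, let $u_d\in L^2(\Omega)$, let $g$ be a real function defined at the vertices of the mesh, and let $g_h\in\mathcal V_h$ be its nodal interpolation. For $K\in\mathcal T_h$, $p,q\in\mathcal V_K$ and $z\in L^2(\Omega)$ put $$(\mathcal A_K)_{pq}=\mathcal A^{SIP}(\phi^K_p,\phi^K_q),\quad (\mathcal N_K)_{pq}=\int_K\phi_p^K\phi_q^K\,dx,\quad (\mathbf b_{z,K})_q=\int_Kz\,\phi_q^K\,dx,\quad (\mathbf b_{d,K})_q=\int_Ku_d\,\phi^K_q\,dx .$$ Consider the element-wise discrete mathematical program with complementarity constraints: minimize $$\sum_{K\in\mathcal T_h}\Big(\tfrac12\,\mathbf u_K^{\top}\mathcal N_K\mathbf u_K-\mathbf u_K^{\top}\mathbf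 b_{d,K}\Big)+\frac\nu2\|z\|_{L^2(\Omega)}^2$$ over $z\in L^2(\Omega)$, $u\in\mathcal V_h$ and $\zeta_K\in\mathbb R^{\mathcal V_K}$ ($K\in\mathcal T_h$), subject to $$\mathcal A_K\mathbf u_K=\zeta_K+\mathbf b_{z,K},\qquad \min(\mathbf u_K-\mathbf g_K,\zeta_K)=0\ \text{ (componentwise)}\qquad\forall K\in\mathcal T_h,$$ where $\mathbf g_K=(g_h^K(p))_{p\in\mathcal V_K}$. Cost and constraints are sums, respectively families, of independent contributions of the elements. **Theorem.** Let $\tilde z_h\in L^2(\Omega)$, with associated state $\tilde u_h\in\mathcal V_h$ and multipliers $\tilde\zeta_K\in\mathbb R^{\mathcal V_K}$, be a (global or local) solution of this program. Then there exist a discrete adjoint state $\tilde p_h\in\mathcal V_h$ and multipliers $\lambda_K\in\mathbb R^{\mathcal V_K}$ such that for every $K\in\mathcal T_h$, writing $\tilde{\mathbf u}_K,\tilde{\mathbf p}_K$ for the vectors of nodal values on $K$ and $\odot$ for the Hadamard product, $$\mathcal A_K\tilde{\mathbf u}_K=\tilde\zeta_K+\mathbf b_{\tilde z_h,K},$$ $$\tilde\zeta_K^{\top}(\tilde{\mathbf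 u}_K-\mathbf g_K)=0,\qquad\tilde\zeta_K\ge0,\qquad\tilde{\mathbf u}_K-\mathbf g_K\ge0,$$ $$\mathcal A_K^{\top}\tilde{\mathbf p}_K=\mathcal N_K\tilde{\mathbf u}_K-\mathbf b_{d,K}+\lambda_K,$$ $$(\tilde{\mathbf u}_K-\mathbf g_K)\odot\lambda_K=0,\qquad\tilde\zeta_K\odot\tilde{\mathbf p}_K=0,$$ $$\lambda_{K,q}\le0\ \text{ and }\ \tilde p_h^K(q)\ge0\quad\text{for all }q\in\mathcal V_K\text{ with }\tilde u_h^K(q)-g_h^K(q)=0=\tilde\zeta_{K,q},$$ $$\nu\tilde z_h(x)+\tilde p_h^K(x)=0\quad\text{for a.e. }x\in K .$$ In particular $\tilde z_h\in\mathcal V_h$. -/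

import Mathlib

open MeasureTheory Matrix

noncomputable section

/-- A regular (that is, conforming simplicial) triangulation of the polygonal or polyhedral set `Ω`:
a finite geometric simplicial complex, all of whose faces are faces of `d`-dimensional simplices,
such that `Ω` is the interior of the union of the simplices. A simplex is given by the finite set of
its vertices, which are affinely independent; two simplices meet in a common face or not at all. -/
structure Triangulation (d : ℕ) (Ω : Set (EuclideanSpace ℝ (Fin d)))
    extends Geometry.SimplicialComplex ℝ (EuclideanSpace ℝ (Fin d)) where
  finite_faces : faces.Finite
  pure_dim : ∀ s ∈ faces, ∃ t ∈ faces, s ⊆ t ∧ t.card = d + 1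
  interior_space : interior toSimplicialComplex.space = Ω

namespace Triangulation

variable {d : ℕ} {Ω : Set (EuclideanSpace ℝ (Fin d))}

/-- The elements `K` of the mesh (triangles if `d = 2`, tetrahedra if `d = 3`), each given by the
set of its vertices. The type `↥K.1` is the set of nodes of `K`, and `↥K.1 → ℝ` is the space of
column vectors indexed by these nodes. -/
def Elem (T : Triangulation d Ω) : Type :=
  {K : Finset (EuclideanSpace ℝ (Fin d)) // K ∈ T.faces ∧ K.card = d + 1}

/-- The edges (`d = 2`) or faces (`d = 3`) of the mesh, on the boundary or not. -/
def Facet (T : Triangulation d Ω) : Type :=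
  {e : Finset (EuclideanSpace ℝ (Fin d)) // e ∈ T.faces ∧ e.card = d}

instance (T : Triangulation d Ω) : Fintype T.Elem :=
  (T.finite_faces.subset (fun _ h => h.1)).fintype

instance (T : Triangulation d Ω) : Fintype T.Facet :=
  (T.finite_faces.subset (fun _ h => h.1)).fintype

instance (T : Triangulation d Ω) : DecidableEq T.Elem := Classical.decEq _

/-- The closed simplex with vertex set `K`. -/
def Elem.carrier {T : Triangulation d Ω} (K : T.Elem) : Set (EuclideanSpace ℝ (Fin d)) :=
  convexHull ℝ (K.1 : Set (EuclideanSpace ℝ (Fin d)))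

/-- The closed edge or face with vertex set `e`. -/
def Facet.carrier {T : Triangulation d Ω} (e : T.Facet) : Set (EuclideanSpace ℝ (Fin d)) :=
  convexHull ℝ (e.1 : Set (EuclideanSpace ℝ (Fin d)))

/-- The length (diameter) `h_e` of an edge or face. -/
def Facet.h {T : Triangulation d Ω} (e : T.Facet) : ℝ := Metric.diam e.carrier

/-- The elements that have `e` as an edge or face: two if `e` is interior, one if `e` lies on the
boundary. -/
def Facet.elems {T : Triangulation d Ω} (e : T.Facet) : Finset T.Elem :=
  open Classical in Finset.univ.filter (fun K => e.1 ⊆ K.1)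

/-- The vertices of an element as an affine basis of `ℝᵈ`. -/
def Elem.basis {T : Triangulation d Ω} (K : T.Elem) :
    AffineBasis (↥K.1) ℝ (EuclideanSpace ℝ (Fin d)) where
  toFun := fun p => p.1
  ind' := T.indep K.2.1
  tot' := by
    refine ((T.indep K.2.1).affineSpan_eq_top_iff_card_eq_finrank_add_one).2 ?_
    simp [K.2.2]

/-- The local Lagrange basis polynomial of `K` at the node `p`: the affine function that is `1` at
`p` and `0` at the other nodes of `K`. -/
def Elem.shape {T : Triangulation d Ω} (K : T.Elem) (p : ↥K.1) :
    EuclideanSpace ℝ (Fin d) →ᵃ[ℝ] ℝ :=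
  K.basis.coord p

/-- The DG space `V_h` of discontinuous piecewise affine functions. A member is given by its
restrictions `v K` (polynomials of degree at most one) to the elements `K`. -/
abbrev DGSpace (T : Triangulation d Ω) : Type :=
  T.Elem → (EuclideanSpace ℝ (Fin d) →ᵃ[ℝ] ℝ)

/-- The coefficient vector of `v ∈ V_h` on the element `K`: its nodal values. -/
def DGSpace.vec {T : Triangulation d Ω} (v : T.DGSpace) (K : T.Elem) : ↥K.1 → ℝ :=
  fun p => v K p.1

/-- The global basis function `φ_p^K ∈ V_h`, which vanishes on all elements other than `K`. -/
def basisFun (T : Triangulation d Ω) (K : T.Elem) (p : ↥K.1) : T.DGSpace :=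
  Pi.single K (K.shape p)

/-- The nodal interpolation `g_h ∈ V_h` of `g`. -/
def nodalInterp (T : Triangulation d Ω) (g : EuclideanSpace ℝ (Fin d) → ℝ) : T.DGSpace :=
  fun K => ∑ p : ↥K.1, g p.1 • K.shape p

/-- A function in `L²(Ω)` belongs to the subspace `V_h`: it is affine on each element. -/
def MemDG (T : Triangulation d Ω) (z : Lp ℝ 2 (volume.restrict Ω)) : Prop :=
  ∃ v : T.DGSpace, ∀ K : T.Elem, ∀ᵐ x ∂(volume.restrict K.carrier), z x = v K x

/-- The outward unit normal to `∂K` on the facet `e` of `K`. If `p` is the vertex of `K` opposite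
to `e`, this is `-∇φ_p / |∇φ_p|`; the gradient is constant, and `p` is the only index of the sum. -/
def outwardNormal {T : Triangulation d Ω} (K : T.Elem) (e : T.Facet) :
    EuclideanSpace ℝ (Fin d) :=
  let w : EuclideanSpace ℝ (Fin d) :=
    open Classical in -∑ p : ↥K.1 with p.1 ∉ e.1, gradient (K.shape p) 0
  ‖w‖⁻¹ • w

/-- The jump of a scalar function on `e`: `v⁺ n⁺ + v⁻ n⁻` if `e` is interior, and `v n` if `e` is on
the boundary. -/
def jump {T : Triangulation d Ω} (e : T.Facet) (v : T.DGSpace) (x : EuclideanSpace ℝ (Fin d)) :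
    EuclideanSpace ℝ (Fin d) :=
  ∑ K ∈ e.elems, v K x • outwardNormal K e

/-- The average of the broken gradient on `e`: the mean of the one-sided values if `e` is interior,
the only one-sided value if `e` is on the boundary. -/
def avgGrad {T : Triangulation d Ω} (e : T.Facet) (v : T.DGSpace)
    (x : EuclideanSpace ℝ (Fin d)) : EuclideanSpace ℝ (Fin d) :=
  ((e.elems.card : ℝ)⁻¹) • ∑ K ∈ e.elems, gradient (v K) x

/-- The broken Dirichlet form `a_h`. -/
def brokenForm (T : Triangulation d Ω) (v w : T.DGSpace) : ℝ :=
  ∑ K : T.Elem, ∫ x in K.carrier, inner ℝ (gradient (v K) x) (gradient (w K) x)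

/-- The consistency, symmetry and penalty terms `b_h`. Integrals over edges or faces are with
respect to the `(d - 1)`-dimensional Hausdorff measure (length or area). -/
def facetForm (T : Triangulation d Ω) (η : ℝ) (w v : T.DGSpace) : ℝ :=
  - ∑ e : T.Facet, ∫ x in e.carrier, inner ℝ (avgGrad e w x) (jump e v x) ∂(μHE[d - 1])
  - ∑ e : T.Facet, ∫ x in e.carrier, inner ℝ (avgGrad e v x) (jump e w x) ∂(μHE[d - 1])
  + ∑ e : T.Facet,
      ∫ x in e.carrier, (η / e.h) * inner ℝ (jump e w x) (jump e v x) ∂(μHE[d - 1])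

/-- The symmetric interior penalty bilinear form with penalty parameter `η`. -/
def sip (T : Triangulation d Ω) (η : ℝ) (v w : T.DGSpace) : ℝ :=
  T.brokenForm v w + T.facetForm η v w

/-- The element matrix of the symmetric interior penalty form. -/
def sipMatrix (T : Triangulation d Ω) (η : ℝ) (K : T.Elem) : Matrix (↥K.1) (↥K.1) ℝ :=
  Matrix.of fun p q => T.sip η (T.basisFun K p) (T.basisFun K q)

/-- The element mass matrix. -/
def massMatrix {T : Triangulation d Ω} (K : T.Elem) : Matrix (↥K.1) (↥K.1) ℝ :=
  Matrix.of fun p q => ∫ x in K.carrier, K.shape p x * K.shape q x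

/-- The element load vector of a function `f ∈ L²(Ω)`: its `q`-entry is `∫_K f φ_q^K`. -/
def loadVec {T : Triangulation d Ω} (K : T.Elem) (f : Lp ℝ 2 (volume.restrict Ω)) : ↥K.1 → ℝ :=
  fun q => ∫ x in K.carrier, f x * K.shape q x

/-- A vector of multipliers on each element. -/
abbrev ElemVecs (T : Triangulation d Ω) : Type := ∀ K : T.Elem, (↥K.1 → ℝ)

/-- The constraints of the discrete problem on every element: the state equation
`A_K u_K = ζ_K + b_{z,K}` and the complementarity condition `min(u_K - g_K, ζ_K) = 0`. -/
def Feasible (T : Triangulation d Ω) (η : ℝ) (g : EuclideanSpace ℝ (Fin d) → ℝ)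
    (z : Lp ℝ 2 (volume.restrict Ω)) (u : T.DGSpace) (ζ : T.ElemVecs) : Prop :=
  ∀ K : T.Elem,
    T.sipMatrix η K *ᵥ u.vec K = ζ K + loadVec K z ∧
    ∀ p : ↥K.1, min (u.vec K p - (T.nodalInterp g).vec K p) (ζ K p) = 0

/-- The cost of the discrete problem: the element contributions
`(1/2) u_Kᵀ N_K u_K - u_Kᵀ b_{d,K}`, plus `(ν/2) ‖z‖²` in `L²(Ω)`. -/
def cost (T : Triangulation d Ω) (ν : ℝ) (ud z : Lp ℝ 2 (volume.restrict Ω))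
    (u : T.DGSpace) : ℝ :=
  ∑ K : T.Elem, ((1 / 2) * (u.vec K ⬝ᵥ (massMatrix K *ᵥ u.vec K)) - u.vec K ⬝ᵥ loadVec K ud)
    + ν / 2 * ‖z‖ ^ 2

/-- `(z, u, ζ)` is a local solution of the discrete mathematical program with complementarity
constraints: it is feasible and its cost is minimal among all nearby feasible triples
(`ζ` is determined by `z` and `u`, hence only these need to be near). Every global solution is a
local solution. -/
def IsLocalSolution (T : Triangulation d Ω) (η ν : ℝ) (g : EuclideanSpace ℝ (Fin d) → ℝ)
    (ud z : Lp ℝ 2 (volume.restrict Ω)) (u : T.DGSpace) (ζ : T.ElemVecs) : Prop :=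
  T.Feasible η g z u ζ ∧
  ∃ ε > 0, ∀ (z' : Lp ℝ 2 (volume.restrict Ω)) (u' : T.DGSpace) (ζ' : T.ElemVecs),
    T.Feasible η g z' u' ζ' → ‖z' - z‖ < ε →
    (∀ (K : T.Elem) (p : ↥K.1), |u'.vec K p - u.vec K p| < ε) →
    T.cost ν ud z u ≤ T.cost ν ud z' u'

end Triangulation

end

open MeasureTheory Matrix

noncomputable section

namespace Triangulation

variable {d : ℕ} {Ω : Set (EuclideanSpace ℝ (Fin d))} {T : Triangulation d Ω}

/-! ### Geometry of the elements -/

/-! The element load vectors `loadVec K f` can be prescribed arbitrarily, already by piecewise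
affine `f` (`exists_loadMap_eq`): on V_h the load map is a Gram operator, hence injective, hence
onto by finite dimension. The control can therefore realise any direction `(y, ξ)` of state and
multiplier: it supplies the load `A_K y_K - ξ_K`, and no invertibility of `A_K` is needed. Only the
complementarity condition restricts `(y, ξ)`, and it decouples node by node, so strong stationarity
follows by testing one node at a time.

Perturbing the control by functions with zero loads leaves state and multiplier unchanged, so `z` is
orthogonal to all of them and lies in V_h (`IsLocalSolution.exists_control_eq`). This permits `p =
-ν z` as adjoint state. Eliminating the control from the derivative of the cost leaves a pairing of
`ξ` with `p` and of `y` with the residual of the adjoint equation (`IsLocalSolution.sum_nonneg`);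
that residual is the multiplier `λ`. -/

lemma Elem.isCompact_carrier (K : T.Elem) : IsCompact K.carrier :=
  K.1.finite_toSet.isCompact_convexHull ℝ

lemma Elem.measurableSet_carrier (K : T.Elem) : MeasurableSet K.carrier :=
  K.isCompact_carrier.isClosed.measurableSet

lemma Elem.convex_carrier (K : T.Elem) : Convex ℝ K.carrier := convex_convexHull ℝ _

lemma Elem.node_mem_carrier (K : T.Elem) (p : ↥K.1) : p.1 ∈ K.carrier :=
  subset_convexHull ℝ _ p.2

lemma Elem.range_basis (K : T.Elem) : Set.range K.basis = (K.1 : Set _) := by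
  change Set.range (fun p : ↥K.1 => p.1) = _
  exact Subtype.range_coe

lemma Elem.carrier_subset_closure_interior (K : T.Elem) :
    K.carrier ⊆ closure (interior K.carrier) := by
  have hne : (interior K.carrier).Nonempty := by
    unfold Elem.carrier
    rw [interior_convexHull_nonempty_iff_affineSpan_eq_top, ← K.range_basis]
    exact K.basis.tot
  rw [K.convex_carrier.closure_interior_eq_closure_of_nonempty_interior hne]
  exact subset_closure

lemma Elem.interior_carrier_subset (K : T.Elem) : interior K.carrier ⊆ Ω := by
  have h := interior_mono (T.convexHull_subset_space K.2.1)
  rw [T.interior_space] at h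
  exact h

/-- Only the interior of an element is sure to lie in the open set `Ω`, but the frontier of a convex
set is null. This makes integrals over closed elements meaningful for classes in L²(Ω). -/
lemma Elem.carrier_ae_le (K : T.Elem) : (K.carrier : Set _) ≤ᵐ[volume] Ω := by
  have h0 : ∀ᵐ x ∂volume, x ∉ frontier K.carrier :=
    measure_eq_zero_iff_ae_notMem.1 (K.convex_carrier.addHaar_frontier volume)
  filter_upwards [h0] with x hx hK
  by_contra hΩ
  refine hx ⟨subset_closure hK, fun hi => hΩ (K.interior_carrier_subset hi)⟩

lemma Elem.restrict_restrict_carrier (K : T.Elem) :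
    (volume.restrict Ω).restrict K.carrier = volume.restrict K.carrier := by
  rw [Measure.restrict_restrict K.measurableSet_carrier]
  refine Measure.restrict_congr_set ?_
  filter_upwards [K.carrier_ae_le] with x hx
  exact propext ⟨fun h => h.1, fun h => ⟨h, hx h⟩⟩

lemma Elem.restrict_carrier_le (K : T.Elem) :
    volume.restrict K.carrier ≤ volume.restrict Ω :=
  Measure.restrict_mono_ae K.carrier_ae_le

/-- Distinct elements overlap in a null set only. -/
lemma Elem.ae_notMem_of_ne {K L : T.Elem} (h : L ≠ K) :
    ∀ᵐ x ∂(volume.restrict K.carrier), x ∉ L.carrier := by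
  rw [ae_restrict_iff' K.measurableSet_carrier]
  -- Both vertex sets have `d + 1` points, so inclusion would force equality.
  have hnot : ¬ K.1 ⊆ L.1 := fun hs =>
    h (Subtype.ext (Finset.eq_of_subset_of_card_le hs (by rw [K.2.2, L.2.2])).symm)
  obtain ⟨q, hqK, hqL⟩ := Finset.not_subset.1 hnot
  -- the common face lies in the hyperplane on which the shape function of `q` vanishes
  have hspan : affineSpan ℝ ((K.1 : Set (EuclideanSpace ℝ (Fin d))) ∩ L.1) ≠ ⊤ := by
    intro htop
    have hq : q ∈ affineSpan ℝ (K.basis '' {p | p.1 ∈ L.1}) := by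
      have : K.basis '' {p | p.1 ∈ L.1} = (K.1 : Set (EuclideanSpace ℝ (Fin d))) ∩ L.1 := by
        ext x
        constructor
        · rintro ⟨p, hp, rfl⟩
          exact ⟨p.2, hp⟩
        · rintro ⟨h1, h2⟩
          exact ⟨⟨x, h1⟩, h2, rfl⟩
      rw [this, htop]
      exact AffineSubspace.mem_top ℝ _ _
    have := (K.basis.ind.mem_affineSpan_iff (⟨q, hqK⟩ : ↥K.1) {p | p.1 ∈ L.1}).1 hq
    exact hqL this
  have hnull := Measure.addHaar_affineSubspace volume _ hspan
  filter_upwards [measure_eq_zero_iff_ae_notMem.1 hnull] with x hx hxK hxL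
  exact hx (convexHull_subset_affineSpan _ (T.inter_subset_convexHull K.2.1 L.2.1 ⟨hxK, hxL⟩))

/-! ### Nodal coordinates -/

/-- The piecewise affine function with given nodal values. -/
def ofVecs : T.ElemVecs →ₗ[ℝ] T.DGSpace where
  toFun c := fun K => ∑ q : ↥K.1, c K q • K.shape q
  map_add' c c' := by
    funext K
    simp [add_smul, Finset.sum_add_distrib]
  map_smul' a c := by
    funext K
    simp [mul_smul, Finset.smul_sum]

lemma ofVecs_apply (c : T.ElemVecs) (K : T.Elem) (x : EuclideanSpace ℝ (Fin d)) :
    ofVecs c K x = ∑ q : ↥K.1, c K q * K.shape q x := by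
  have : ∀ s : Finset ↥K.1, (∑ q ∈ s, c K q • K.shape q) x = ∑ q ∈ s, c K q * K.shape q x := by
    classical
    intro s
    induction s using Finset.induction_on with
    | empty => simp
    | insert a s ha ih => simp [Finset.sum_insert ha, ih]
  exact this _

open Classical in
lemma Elem.shape_node (K : T.Elem) (q p : ↥K.1) : K.shape q p.1 = if q = p then 1 else 0 :=
  K.basis.coord_apply q p

@[simp] lemma vec_ofVecs (c : T.ElemVecs) (K : T.Elem) : (ofVecs c).vec K = c K := by
  classical
  funext p
  simp [DGSpace.vec, ofVecs_apply, Elem.shape_node]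

lemma vec_add_smul (u v : T.DGSpace) (t : ℝ) (K : T.Elem) :
    (u + t • v).vec K = u.vec K + t • v.vec K := by
  funext p
  simp [DGSpace.vec]

lemma continuous_of_affine (f : EuclideanSpace ℝ (Fin d) →ᵃ[ℝ] ℝ) : Continuous f :=
  f.continuous_of_finiteDimensional

/-! ### Piecewise affine functions as members of `L²(Ω)` -/

lemma Elem.memLp_affine (K : T.Elem) (f : EuclideanSpace ℝ (Fin d) →ᵃ[ℝ] ℝ) :
    MemLp f 2 (volume.restrict K.carrier) := by
  have hc := continuous_of_affine f
  obtain ⟨C, hC⟩ := K.isCompact_carrier.exists_bound_of_continuousOn hc.continuousOn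
  have : IsFiniteMeasure (volume.restrict K.carrier) :=
    ⟨by simpa using K.isCompact_carrier.measure_lt_top⟩
  exact MemLp.of_bound hc.aestronglyMeasurable C
    ((ae_restrict_iff' K.measurableSet_carrier).2 (Filter.Eventually.of_forall hC))

lemma Elem.memLp_indicator_affine (K : T.Elem) (f : EuclideanSpace ℝ (Fin d) →ᵃ[ℝ] ℝ) :
    MemLp (K.carrier.indicator f) 2 (volume.restrict Ω) := by
  rw [memLp_indicator_iff_restrict K.measurableSet_carrier, K.restrict_restrict_carrier]
  exact K.memLp_affine f

lemma Elem.integrable_mul_affine (K : T.Elem) (f : Lp ℝ 2 (volume.restrict Ω))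
    (a : EuclideanSpace ℝ (Fin d) →ᵃ[ℝ] ℝ) :
    Integrable (fun x => f x * a x) (volume.restrict K.carrier) :=
  ((Lp.memLp f).mono_measure K.restrict_carrier_le).integrable_mul (K.memLp_affine a)

lemma memLp_broken (v : T.DGSpace) :
    MemLp (fun x => ∑ K : T.Elem, K.carrier.indicator (v K) x) 2 (volume.restrict Ω) :=
  memLp_finsetSum _ fun K _ => K.memLp_indicator_affine (v K)

/-- The embedding of the discontinuous piecewise affine functions into `L²(Ω)`. -/
def toL2 : T.DGSpace →ₗ[ℝ] Lp ℝ 2 (volume.restrict Ω) where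
  toFun v := (memLp_broken v).toLp _
  map_add' v w := by
    rw [← MemLp.toLp_add]
    congr 1
    funext x
    simp only [Pi.add_apply, ← Finset.sum_add_distrib]
    refine Finset.sum_congr rfl fun K _ => ?_
    by_cases h : x ∈ K.carrier <;> simp [h]
  map_smul' a v := by
    rw [RingHom.id_apply, ← MemLp.toLp_const_smul]
    congr 1
    funext x
    simp only [Pi.smul_apply, Finset.smul_sum]
    refine Finset.sum_congr rfl fun K _ => ?_
    by_cases h : x ∈ K.carrier <;> simp [h]

lemma coeFn_toL2 (v : T.DGSpace) :
    toL2 v =ᵐ[volume.restrict Ω] fun x => ∑ K : T.Elem, K.carrier.indicator (v K) x :=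
  (memLp_broken v).coeFn_toLp

lemma coeFn_toL2_carrier (v : T.DGSpace) (K : T.Elem) :
    ∀ᵐ x ∂(volume.restrict K.carrier), toL2 v x = v K x := by
  have h1 := ae_mono K.restrict_carrier_le (coeFn_toL2 v)
  have h2 : ∀ᵐ x ∂(volume.restrict K.carrier), ∀ L : T.Elem, L ≠ K → x ∉ L.carrier := by
    rw [ae_all_iff]
    intro L
    by_cases h : L = K
    · simp [h]
    · filter_upwards [Elem.ae_notMem_of_ne h] with x hx _ using hx
  filter_upwards [h1, h2, ae_restrict_mem K.measurableSet_carrier] with x hx hL hK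
  rw [hx, Finset.sum_eq_single K (fun L _ hne => Set.indicator_of_notMem (hL L hne) _)
    (fun h => absurd (Finset.mem_univ K) h), Set.indicator_of_mem hK]

/-- An affine function vanishing a.e. on an element vanishes on all of it by continuity, since the
element lies in the closure of its interior; its nodal values then determine it. -/
lemma toL2_injective : Function.Injective (toL2 (T := T)) := by
  refine (injective_iff_map_eq_zero _).2 fun v hv => ?_
  funext K
  have h0 : (v K : _ → ℝ) =ᵐ[volume.restrict K.carrier] fun _ => (0 : ℝ) := by
    have hz := ae_mono K.restrict_carrier_le (Lp.coeFn_zero ℝ 2 (volume.restrict Ω))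
    filter_upwards [coeFn_toL2_carrier v K, hz] with x hx hz
    rw [← hx, hv, hz]
    rfl
  have heq := Measure.eqOn_of_ae_eq h0 (continuous_of_affine (v K)).continuousOn
    continuousOn_const K.carrier_subset_closure_interior
  refine AffineMap.ext_on (s := Set.range K.basis) K.basis.tot ?_
  rintro _ ⟨p, rfl⟩
  exact heq (K.node_mem_carrier p)

lemma inner_toL2 (v : T.DGSpace) (f : Lp ℝ 2 (volume.restrict Ω)) :
    inner ℝ (toL2 v) f = ∑ K : T.Elem, ∫ x in K.carrier, f x * v K x := by
  have hind : ∀ (K : T.Elem) (x : EuclideanSpace ℝ (Fin d)),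
      f x * K.carrier.indicator (v K) x = K.carrier.indicator (fun x => f x * v K x) x := by
    intro K x
    by_cases h : x ∈ K.carrier <;> simp [h]
  calc inner ℝ (toL2 v) f
      = ∫ x in Ω, ∑ K : T.Elem, K.carrier.indicator (fun x => f x * v K x) x := by
        rw [L2.inner_def]
        refine integral_congr_ae ?_
        filter_upwards [coeFn_toL2 v] with x hx
        simp only [hx, RCLike.inner_apply, conj_trivial, ← hind, ← Finset.mul_sum]
    _ = ∑ K : T.Elem, ∫ x in Ω, K.carrier.indicator (fun x => f x * v K x) x := by
        refine integral_finsetSum _ fun K _ => ?_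
        rw [integrable_indicator_iff K.measurableSet_carrier, IntegrableOn,
          K.restrict_restrict_carrier]
        exact K.integrable_mul_affine f (v K)
    _ = _ := by
        refine Finset.sum_congr rfl fun K _ => ?_
        rw [integral_indicator K.measurableSet_carrier, K.restrict_restrict_carrier]

lemma inner_toL2_ofVecs (c : T.ElemVecs) (f : Lp ℝ 2 (volume.restrict Ω)) :
    inner ℝ (toL2 (ofVecs c)) f = ∑ K : T.Elem, c K ⬝ᵥ loadVec K f := by
  rw [inner_toL2]
  refine Finset.sum_congr rfl fun K _ => ?_
  simp only [ofVecs_apply, dotProduct, loadVec, Finset.mul_sum, ← integral_const_mul]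
  rw [integral_finsetSum]
  · refine Finset.sum_congr rfl fun q _ => integral_congr_ae (Filter.Eventually.of_forall ?_)
    intro x
    ring
  · intro q _
    refine ((K.integrable_mul_affine f (K.shape q)).const_mul (c K q)).congr
      (Filter.Eventually.of_forall fun x => ?_)
    ring

/-! ### Surjectivity of the load map -/

/-- The element load vectors, as a linear function of the load. -/
def loadMap : Lp ℝ 2 (volume.restrict Ω) →ₗ[ℝ] T.ElemVecs where
  toFun f := fun K => loadVec K f
  map_add' f g := by
    funext K q
    simp only [loadVec, Pi.add_apply]
    rw [← integral_add (K.integrable_mul_affine f _) (K.integrable_mul_affine g _)]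
    refine integral_congr_ae ?_
    filter_upwards [ae_mono K.restrict_carrier_le (Lp.coeFn_add f g)] with x hx
    rw [hx, Pi.add_apply, add_mul]
  map_smul' a f := by
    funext K q
    simp only [loadVec, Pi.smul_apply, RingHom.id_apply, smul_eq_mul]
    rw [← integral_const_mul]
    refine integral_congr_ae ?_
    filter_upwards [ae_mono K.restrict_carrier_le (Lp.coeFn_smul a f)] with x hx
    rw [hx, Pi.smul_apply, smul_eq_mul, mul_assoc]

lemma loadMap_apply (f : Lp ℝ 2 (volume.restrict Ω)) (K : T.Elem) :
    loadMap f K = loadVec K f := rfl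

/-- Arbitrary element load vectors are attained by a piecewise affine load. -/
lemma exists_loadMap_eq (b : T.ElemVecs) : ∃ c : T.ElemVecs, loadMap (toL2 (ofVecs c)) = b := by
  have hinj : Function.Injective (loadMap ∘ₗ toL2 ∘ₗ ofVecs : T.ElemVecs →ₗ[ℝ] T.ElemVecs) := by
    refine (injective_iff_map_eq_zero _).2 fun c hc => ?_
    -- The pairing of a piecewise affine function with itself is a combination of its own loads,
    -- which vanish.
    have hin : inner ℝ (toL2 (ofVecs c)) (toL2 (ofVecs c)) = (0 : ℝ) := by
      rw [inner_toL2_ofVecs]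
      refine Finset.sum_eq_zero fun K _ => ?_
      rw [← loadMap_apply, show loadMap (toL2 (ofVecs c)) = 0 from hc]
      simp
    have h0 : ofVecs c = 0 :=
      toL2_injective ((inner_self_eq_zero.1 hin).trans (map_zero toL2).symm)
    funext K
    rw [← vec_ofVecs c K, h0]
    rfl
  exact LinearMap.injective_iff_surjective.1 hinj b

/-! ### First-order conditions -/

lemma massMatrix_isSymm (K : T.Elem) : (massMatrix K)ᵀ = massMatrix K := by
  ext p q
  simp [massMatrix, mul_comm]

lemma dotProduct_massMatrix_comm (K : T.Elem) (a b : ↥K.1 → ℝ) :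
    a ⬝ᵥ (massMatrix K *ᵥ b) = b ⬝ᵥ (massMatrix K *ᵥ a) := by
  rw [dotProduct_mulVec, ← mulVec_transpose, massMatrix_isSymm, dotProduct_comm]

/-- The derivative of the cost in the direction `(w, v)`. -/
def costDeriv (ν : ℝ) (ud z : Lp ℝ 2 (volume.restrict Ω)) (u : T.DGSpace)
    (w : Lp ℝ 2 (volume.restrict Ω)) (v : T.DGSpace) : ℝ :=
  ∑ K : T.Elem, v.vec K ⬝ᵥ (massMatrix K *ᵥ u.vec K - loadVec K ud) + ν * inner ℝ z w

lemma cost_add_smul (ν : ℝ) (ud z : Lp ℝ 2 (volume.restrict Ω)) (u : T.DGSpace)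
    (w : Lp ℝ 2 (volume.restrict Ω)) (v : T.DGSpace) (t : ℝ) :
    T.cost ν ud (z + t • w) (u + t • v) = T.cost ν ud z u + t * costDeriv ν ud z u w v +
      t ^ 2 * (∑ K : T.Elem, 1 / 2 * (v.vec K ⬝ᵥ (massMatrix K *ᵥ v.vec K)) +
        ν / 2 * ‖w‖ ^ 2) := by
  have hn : ‖z + t • w‖ ^ 2 = ‖z‖ ^ 2 + 2 * (t * inner ℝ z w) + t ^ 2 * ‖w‖ ^ 2 := by
    rw [norm_add_sq_real, real_inner_smul_right, norm_smul, mul_pow, Real.norm_eq_abs, sq_abs]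
  have hs : ∑ K : T.Elem, (1 / 2 * ((u + t • v).vec K ⬝ᵥ (massMatrix K *ᵥ (u + t • v).vec K)) -
        (u + t • v).vec K ⬝ᵥ loadVec K ud) =
      ∑ K : T.Elem, (1 / 2 * (u.vec K ⬝ᵥ (massMatrix K *ᵥ u.vec K)) - u.vec K ⬝ᵥ loadVec K ud) +
      t * ∑ K : T.Elem, v.vec K ⬝ᵥ (massMatrix K *ᵥ u.vec K - loadVec K ud) +
      t ^ 2 * ∑ K : T.Elem, 1 / 2 * (v.vec K ⬝ᵥ (massMatrix K *ᵥ v.vec K)) := by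
    rw [Finset.mul_sum, Finset.mul_sum, ← Finset.sum_add_distrib, ← Finset.sum_add_distrib]
    refine Finset.sum_congr rfl fun K _ => ?_
    simp only [vec_add_smul, add_dotProduct, mulVec_add, dotProduct_add, mulVec_smul,
      smul_dotProduct, dotProduct_smul, dotProduct_sub, smul_eq_mul]
    rw [dotProduct_massMatrix_comm K (u.vec K) (v.vec K)]
    ring
  unfold cost costDeriv
  rw [hs, hn]
  ring

/-- Divide by `t > 0` and let `t` tend to 0. As the cost is exactly quadratic along a line, no
further differentiability argument is needed. -/
lemma nonneg_of_eventually_nonneg {a b : ℝ}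
    (h : ∀ᶠ t : ℝ in nhdsWithin 0 (Set.Ioi 0), 0 ≤ t * a + t ^ 2 * b) : 0 ≤ a := by
  have hlim : Filter.Tendsto (fun t : ℝ => a + t * b) (nhdsWithin 0 (Set.Ioi 0)) (nhds a) := by
    have : Continuous fun t : ℝ => a + t * b := by fun_prop
    simpa using (this.tendsto 0).mono_left nhdsWithin_le_nhds
  refine ge_of_tendsto hlim ?_
  filter_upwards [h, self_mem_nhdsWithin] with t ht (ht0 : 0 < t)
  have : 0 ≤ t * (a + t * b) := by nlinarith
  exact nonneg_of_mul_nonneg_right this ht0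

variable {η ν : ℝ} {g : EuclideanSpace ℝ (Fin d) → ℝ} {ud z : Lp ℝ 2 (volume.restrict Ω)}
  {u : T.DGSpace} {ζ : T.ElemVecs}

/-- The cost does not decrease along feasible directions from a local solution. -/
lemma IsLocalSolution.costDeriv_nonneg (hsol : T.IsLocalSolution η ν g ud z u ζ)
    {w : Lp ℝ 2 (volume.restrict Ω)} {v : T.DGSpace} {ξ : T.ElemVecs}
    (hstate : ∀ K, T.sipMatrix η K *ᵥ v.vec K = ξ K + loadVec K w)
    (hcompl : ∀ᶠ t : ℝ in nhdsWithin 0 (Set.Ioi 0), ∀ (K : T.Elem) (p : ↥K.1),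
      min (u.vec K p + t * v.vec K p - (T.nodalInterp g).vec K p) (ζ K p + t * ξ K p) = 0) :
    0 ≤ costDeriv ν ud z u w v := by
  obtain ⟨hfeas, ε, hε, hmin⟩ := hsol
  refine nonneg_of_eventually_nonneg
    (b := ∑ K : T.Elem, 1 / 2 * (v.vec K ⬝ᵥ (massMatrix K *ᵥ v.vec K)) + ν / 2 * ‖w‖ ^ 2) ?_
  have hw : ∀ᶠ t : ℝ in nhdsWithin 0 (Set.Ioi 0), ‖t • w‖ < ε := by
    have hc : Continuous fun t : ℝ => ‖t • w‖ := by fun_prop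
    exact nhdsWithin_le_nhds (hc.tendsto 0 (Iio_mem_nhds (by simpa using hε)))
  have hv : ∀ᶠ t : ℝ in nhdsWithin 0 (Set.Ioi 0), ∀ (K : T.Elem) (p : ↥K.1),
      |t * v.vec K p| < ε := by
    simp only [Filter.eventually_all]
    intro K p
    have hc : Continuous fun t : ℝ => |t * v.vec K p| := by fun_prop
    exact nhdsWithin_le_nhds (hc.tendsto 0 (Iio_mem_nhds (by simpa using hε)))
  filter_upwards [hw, hv, hcompl] with t htw htv htc
  have hle := hmin (z + t • w) (u + t • v) (ζ + t • ξ) ?_ (by simpa using htw) ?_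
  · rw [cost_add_smul] at hle
    linarith
  · intro K
    refine ⟨?_, fun p => ?_⟩
    · have hl : loadVec K (z + t • w) = loadVec K z + t • loadVec K w := by
        simp only [← loadMap_apply, map_add, map_smul, Pi.add_apply, Pi.smul_apply]
      rw [vec_add_smul, mulVec_add, mulVec_smul, hl, (hfeas K).1, hstate K]
      simp only [Pi.add_apply, Pi.smul_apply, smul_add]
      abel
    · simpa [vec_add_smul] using htc K p
  · intro K p
    simpa [vec_add_smul] using htv K p

/-- The control of a local solution is piecewise affine. -/
lemma IsLocalSolution.exists_control_eq (hν : 0 < ν)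
    (hsol : T.IsLocalSolution η ν g ud z u ζ) : ∃ c : T.ElemVecs, z = toL2 (ofVecs c) := by
  -- Equal loads make `c` the coefficients of the L² projection of `z` onto V_h.
  obtain ⟨c, hc⟩ := exists_loadMap_eq (loadMap z : T.ElemVecs)
  refine ⟨c, ?_⟩
  set w := z - toL2 (ofVecs c) with hw
  have hload : (loadMap w : T.ElemVecs) = 0 := by rw [hw, map_sub, hc, sub_self]
  have hdir : ∀ w' : Lp ℝ 2 (volume.restrict Ω), (loadMap w' : T.ElemVecs) = 0 →
      0 ≤ inner ℝ z w' := by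
    intro w' hw'
    have hz : ∀ K : T.Elem, (0 : T.DGSpace).vec K = 0 := fun K => rfl
    have h := hsol.costDeriv_nonneg (w := w') (v := 0) (ξ := 0)
      (fun K => by rw [hz, ← loadMap_apply, hw']; simp)
      (Filter.Eventually.of_forall fun t K p => by simpa [hz] using (hsol.1 K).2 p)
    simp only [costDeriv, hz, zero_dotProduct, Finset.sum_const_zero, zero_add] at h
    exact nonneg_of_mul_nonneg_right h hν
  have h1 := hdir w hload
  -- The zero-load functions form a subspace, so both signs are admissible and `w` is orthogonal to
  -- `z`.
  have h2 := hdir (-w) (by rw [map_neg, hload, neg_zero])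
  rw [inner_neg_right] at h2
  have h3 : inner ℝ (toL2 (ofVecs c)) w = 0 := by
    rw [inner_toL2_ofVecs]
    refine Finset.sum_eq_zero fun K _ => ?_
    rw [← loadMap_apply, hload]
    simp
  have h4 : inner ℝ w w = (0 : ℝ) := by
    nth_rw 1 [hw]
    rw [inner_sub_left, h3]
    linarith
  exact sub_eq_zero.1 (inner_self_eq_zero.1 h4)

/-- The first-order condition after elimination of the control by the adjoint state. -/
lemma IsLocalSolution.sum_nonneg (hsol : T.IsLocalSolution η ν g ud z u ζ)
    {p : T.ElemVecs} (hp : ν • z = -toL2 (ofVecs p)) (y ξ : T.ElemVecs)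
    (hcompl : ∀ᶠ t : ℝ in nhdsWithin 0 (Set.Ioi 0), ∀ (K : T.Elem) (q : ↥K.1),
      min (u.vec K q + t * y K q - (T.nodalInterp g).vec K q) (ζ K q + t * ξ K q) = 0) :
    0 ≤ ∑ K : T.Elem, (p K ⬝ᵥ ξ K - y K ⬝ᵥ
      ((T.sipMatrix η K)ᵀ *ᵥ p K - massMatrix K *ᵥ u.vec K + loadVec K ud)) := by
  -- The control direction is chosen to satisfy the linearised state equation for the given `y` and
  -- `ξ`.
  obtain ⟨c, hc⟩ := exists_loadMap_eq (fun K => T.sipMatrix η K *ᵥ y K - ξ K : T.ElemVecs)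
  have hcK : ∀ K : T.Elem, loadVec K (toL2 (ofVecs c)) = T.sipMatrix η K *ᵥ y K - ξ K :=
    fun K => congrFun hc K
  have h := hsol.costDeriv_nonneg (w := toL2 (ofVecs c)) (v := ofVecs y) (ξ := ξ)
    (fun K => by rw [hcK, vec_ofVecs]; abel) (by simpa using hcompl)
  rw [costDeriv, ← real_inner_smul_left, hp, inner_neg_left, inner_toL2_ofVecs,
    ← sub_eq_add_neg, ← Finset.sum_sub_distrib] at h
  refine h.trans_eq (Finset.sum_congr rfl fun K _ => ?_)
  have hT : y K ⬝ᵥ ((T.sipMatrix η K)ᵀ *ᵥ p K) = p K ⬝ᵥ (T.sipMatrix η K *ᵥ y K) := by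
    rw [mulVec_transpose, dotProduct_comm, ← dotProduct_mulVec]
  rw [vec_ofVecs, hcK, dotProduct_sub, dotProduct_sub, dotProduct_add, dotProduct_sub, hT]
  ring

/-! ### Variations at a single node -/

open Classical in
/-- The family of vectors whose only nonzero entry is `a`, at the node `q` of `K`. -/
def singleVec (K : T.Elem) (q : ↥K.1) (a : ℝ) : T.ElemVecs := Pi.single K (Pi.single q a)

/-- Reduces complementarity along a one-node direction to that node; elsewhere the entry is 0 and
feasibility of the solution itself applies. -/
lemma singleVec_cases (K : T.Elem) (q : ↥K.1) (a : ℝ) {P : ∀ L : T.Elem, ↥L.1 → ℝ → Prop}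
    (h : P K q a) (h0 : ∀ L r, P L r 0) (L : T.Elem) (r : ↥L.1) :
    P L r (singleVec K q a L r) := by
  classical
  by_cases hL : L = K
  · subst hL
    by_cases hr : r = q
    · subst hr
      simpa [singleVec] using h
    · simpa [singleVec, hr] using h0 L r
  · simpa [singleVec, hL] using h0 L r

lemma sum_dotProduct_singleVec (K : T.Elem) (q : ↥K.1) (a : ℝ) (b : T.ElemVecs) :
    ∑ L : T.Elem, singleVec K q a L ⬝ᵥ b L = a * b K q := by
  classical
  rw [Finset.sum_eq_single K (fun L _ hL => by simp [singleVec, hL]) (by simp)]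
  simp [singleVec]

/-- The state is frozen and one multiplier entry moves, the control compensating. -/
lemma IsLocalSolution.mul_adjoint_nonneg (hsol : T.IsLocalSolution η ν g ud z u ζ)
    {p : T.ElemVecs} (hp : ν • z = -toL2 (ofVecs p)) (K : T.Elem) (q : ↥K.1) (a : ℝ)
    (ha : ∀ᶠ t : ℝ in nhdsWithin 0 (Set.Ioi 0),
      min (u.vec K q - (T.nodalInterp g).vec K q) (ζ K q + t * a) = 0) :
    0 ≤ a * p K q := by
  have h := hsol.sum_nonneg hp 0 (singleVec K q a) (ha.mono fun t ht =>
    singleVec_cases K q a (P := fun L r x => min (u.vec L r + t * (0 : T.ElemVecs) L r -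
      (T.nodalInterp g).vec L r) (ζ L r + t * x) = 0)
      (by simpa using ht) (fun L r => by simpa using (hsol.1 L).2 r))
  have h' := sum_dotProduct_singleVec K q a p
  simp only [Pi.zero_apply, zero_dotProduct, sub_zero, dotProduct_comm (p _)] at h
  rwa [h'] at h

/-- The counterpart with all multipliers frozen and one nodal value of the state moving. -/
lemma IsLocalSolution.mul_multiplier_nonpos (hsol : T.IsLocalSolution η ν g ud z u ζ)
    {p : T.ElemVecs} (hp : ν • z = -toL2 (ofVecs p)) (K : T.Elem) (q : ↥K.1) (a : ℝ)
    (ha : ∀ᶠ t : ℝ in nhdsWithin 0 (Set.Ioi 0),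
      min (u.vec K q + t * a - (T.nodalInterp g).vec K q) (ζ K q) = 0) :
    a * ((T.sipMatrix η K)ᵀ *ᵥ p K - massMatrix K *ᵥ u.vec K + loadVec K ud) q ≤ 0 := by
  have h := hsol.sum_nonneg hp (singleVec K q a) 0 (ha.mono fun t ht =>
    singleVec_cases K q a (P := fun L r x => min (u.vec L r + t * x -
      (T.nodalInterp g).vec L r) (ζ L r + t * (0 : T.ElemVecs) L r) = 0)
      (by simpa using ht) (fun L r => by simpa using (hsol.1 L).2 r))
  have h' := sum_dotProduct_singleVec K q a
    (fun K => (T.sipMatrix η K)ᵀ *ᵥ p K - massMatrix K *ᵥ u.vec K + loadVec K ud)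
  simp only [Pi.zero_apply, dotProduct_zero, zero_sub, Finset.sum_neg_distrib] at h
  rw [h'] at h
  linarith

lemma eventually_add_mul_pos {x : ℝ} (hx : 0 < x) (a : ℝ) :
    ∀ᶠ t : ℝ in nhdsWithin 0 (Set.Ioi 0), 0 < x + t * a := by
  have hc : Continuous fun t : ℝ => x + t * a := by fun_prop
  exact nhdsWithin_le_nhds (hc.tendsto 0 (Ioi_mem_nhds (by simpa using hx)))

end Triangulation

end

/-! ### The strong stationarity system -/

theorem theorem4p4 {d : ℕ} (hd : d = 2 ∨ d = 3) {Ω : Set (EuclideanSpace ℝ (Fin d))}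
    (T : Triangulation d Ω) (η ν : ℝ) (hη : 0 < η) (hν : 0 < ν)
    (g : EuclideanSpace ℝ (Fin d) → ℝ) (ud : Lp ℝ 2 (volume.restrict Ω))
    (z : Lp ℝ 2 (volume.restrict Ω)) (u : T.DGSpace) (ζ : T.ElemVecs)
    (hsol : T.IsLocalSolution η ν g ud z u ζ) :
    (∃ (p : T.DGSpace) (l : T.ElemVecs), ∀ K : T.Elem,
      T.sipMatrix η K *ᵥ u.vec K = ζ K + Triangulation.loadVec K z ∧
      (ζ K ⬝ᵥ (u.vec K - (T.nodalInterp g).vec K) = 0 ∧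
        (∀ q, 0 ≤ ζ K q) ∧ ∀ q, 0 ≤ u.vec K q - (T.nodalInterp g).vec K q) ∧
      (T.sipMatrix η K)ᵀ *ᵥ p.vec K =
        Triangulation.massMatrix K *ᵥ u.vec K - Triangulation.loadVec K ud + l K ∧
      (u.vec K - (T.nodalInterp g).vec K) * l K = 0 ∧
      ζ K * p.vec K = 0 ∧
      (∀ q, u.vec K q - (T.nodalInterp g).vec K q = 0 → ζ K q = 0 →
        l K q ≤ 0 ∧ 0 ≤ p.vec K q) ∧
      ∀ᵐ x ∂(volume.restrict K.carrier), ν * z x + p K x = 0) ∧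
    T.MemDG z := by
  obtain ⟨c, hc⟩ := hsol.exists_control_eq hν
  have hzc : ∀ K : T.Elem, ∀ᵐ x ∂(volume.restrict K.carrier),
      z x = Triangulation.ofVecs c K x := by
    intro K
    rw [hc]
    exact Triangulation.coeFn_toL2_carrier _ K
  have hp : ν • z = -Triangulation.toL2 (Triangulation.ofVecs (-(ν • c))) := by
    rw [map_neg, map_neg, map_smul, map_smul, neg_neg, hc]
  set p : T.ElemVecs := -(ν • c) with hpdef
  -- `λ` is taken as the residual, so the adjoint equation holds by construction.
  refine ⟨⟨Triangulation.ofVecs p, fun K => (T.sipMatrix η K)ᵀ *ᵥ p K -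
    Triangulation.massMatrix K *ᵥ u.vec K + Triangulation.loadVec K ud, fun K => ?_⟩,
    Triangulation.ofVecs c, hzc⟩
  simp only [Triangulation.vec_ofVecs]
  have hcompl := (hsol.1 K).2
  have hζ : ∀ q, 0 ≤ ζ K q := fun q => (hcompl q).symm.trans_le (min_le_right _ _)
  have hu : ∀ q, 0 ≤ u.vec K q - (T.nodalInterp g).vec K q :=
    fun q => (hcompl q).symm.trans_le (min_le_left _ _)
  have hor : ∀ q, u.vec K q - (T.nodalInterp g).vec K q = 0 ∨ ζ K q = 0 := fun q =>
    (min_choice _ _).imp (fun h => h.symm.trans (hcompl q)) (fun h => h.symm.trans (hcompl q))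
  refine ⟨(hsol.1 K).1, ⟨?_, hζ, hu⟩, by abel, ?_, ?_, ?_, ?_⟩
  · refine Finset.sum_eq_zero fun q _ => ?_
    rcases hor q with h | h <;> simp [h]
  · funext q
    by_cases h : u.vec K q - (T.nodalInterp g).vec K q = 0
    · simp [h]
    · have hζ0 := (hor q).resolve_left h
      -- Off the obstacle the state may move either way, which forces `λ` to vanish there.
      have hev : ∀ a : ℝ, ∀ᶠ t : ℝ in nhdsWithin 0 (Set.Ioi 0),
          min (u.vec K q + t * a - (T.nodalInterp g).vec K q) (ζ K q) = 0 := fun a => by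
        filter_upwards [Triangulation.eventually_add_mul_pos
          (lt_of_le_of_ne (hu q) (Ne.symm h)) a] with t ht
        rw [hζ0]
        exact min_eq_right (by linarith)
      have h1 := hsol.mul_multiplier_nonpos hp K q 1 (hev 1)
      have h2 := hsol.mul_multiplier_nonpos hp K q (-1) (hev (-1))
      rw [Pi.mul_apply, Pi.zero_apply]
      exact mul_eq_zero_of_right _ (by linarith)
  · funext q
    by_cases h : ζ K q = 0
    · simp [h]
    · have hu0 := (hor q).resolve_right h
      -- A positive multiplier entry may move either way.
      have hev : ∀ a : ℝ, ∀ᶠ t : ℝ in nhdsWithin 0 (Set.Ioi 0),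
          min (u.vec K q - (T.nodalInterp g).vec K q) (ζ K q + t * a) = 0 := fun a => by
        filter_upwards [Triangulation.eventually_add_mul_pos
          (lt_of_le_of_ne (hζ q) (Ne.symm h)) a] with t ht
        rw [hu0]
        exact min_eq_left ht.le
      have h1 := hsol.mul_adjoint_nonneg hp K q 1 (hev 1)
      have h2 := hsol.mul_adjoint_nonneg hp K q (-1) (hev (-1))
      rw [Pi.mul_apply, Pi.zero_apply]
      exact mul_eq_zero_of_right _ (by linarith)
  · intro q hu0 hζ0
    -- At a biactive node only increases are feasible, of the state or of the multiplier separately;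
    -- each yields one sign.
    have h1 := hsol.mul_multiplier_nonpos hp K q 1 (by
      filter_upwards [self_mem_nhdsWithin] with t (ht : 0 < t)
      rw [hζ0]
      exact min_eq_right (by linarith))
    have h2 := hsol.mul_adjoint_nonneg hp K q 1 (by
      filter_upwards [self_mem_nhdsWithin] with t (ht : 0 < t)
      rw [hu0, hζ0]
      exact min_eq_left (by linarith))
    exact ⟨by linarith, by linarith⟩
  · filter_upwards [hzc K] with x hx
    rw [hx, hpdef, map_neg, map_smul]
    simp
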